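/- Let $\lambda=\sum_{k=1}^{\infty}2^{-k}\delta_k$ be the probability measure on $\mathbb R$ with an atom of weight $2^{-k}$ at $k$ for each $k=1,2,3,\dots$, and put $\Lambda(x)=\lambda(-\infty,x]$. Functions are real-valued and $\lambda$-measurable, and are identified when equal $\lambda$-a.e. For a function $f$ let $\tilde f(x)=\operatorname{ess\,sup}_\lambda\{|f(y)|:y\ge x\}$ be its least decreasing majorant. A non-negative $\lambda$-measurable $F:\mathbb R\to[0,\infty)$ is called $\lambda$-concave if $(\Lambda(b)-\Lambda(x))(F(x)-F(a))\ge (F(b)-F(x))(\Lambda(x)-\Lambda(a))$ whenever $a\le x\le b$. The level function $f^o$ is the Radon–Nikodym derivative with respect to $\lambda$ of the least $\lambda$-concave majorant of $x\mapsto\int_{(-\infty,x]}|f|\,d\lambda$ if a finite such majorant exists, and otherwise $f^o=\sup_n(\min(|f|,n))^o$. Let $\operatorname{Int}_1(L^1_\lambda,L^\infty_\lambda)$ be the collection of exact interpolation spaces: the Banach spaces $X$, linear subspaces of $L^1_\lambda+L^\infty_\lambda$ containing $L^1_\lambda\cap L^\infty_\lambda$, such that every linear operator $T$ on $L^1_\lambda+L^\infty_\lambda$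 that maps $L^1_\lambda$ to $L^1_\lambda$ and $L^\infty_\lambda$ to $L^\infty_\lambda$ boundedly, the larger of the two operator norms being $1$, maps $X$ to $X$ with norm at most $1$. For such $X$ let $\tilde X=\{f:\tilde f\in X\}$ with $\|f\|_{\tilde X}=\|\tilde f\|_X$, and $X^o=\{f:f^o\in X\}$ with $\|f\|_{X^o}=\|f^o\|_X$. Then for every $X\in\operatorname{Int}_1(L^1_\lambda,L^\infty_\lambda)$: $\tilde X=L^\infty_\lambda$ with equivalent norms, and $X^o=L^1_\lambda$ with equivalent norms. That is, the sets coincide, and there are constants $c,C>0$ (depending on $X$) such that $c\|f\|_{L^\infty_\lambda}\le\|f\|_{\tilde X}\le C\|f\|_{L^\infty_\lambda}$ for all $f\in L^\infty_\lambda$ and $c\|f\|_{L^1_\lambda}\le\|f\|_{X^o}\le C\|f\|_{L^1_\lambda}$ for all $f\in L^1_\lambda$. -/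

import Mathlib

open MeasureTheory
open scoped ENNReal Topology

noncomputable section

/-! ### Banach spaces inside an ambient vector space, and interpolation between them -/

/-- A linear subspace of `V` with a complete norm of its own. The values of `norm` outside
`carrier` carry no meaning. -/
structure BanachSubspace (V : Type*) [AddCommGroup V] [Module ℝ V] where
  carrier : Submodule ℝ V
  norm : V → ℝ
  norm_nonneg : ∀ x ∈ carrier, 0 ≤ norm x
  norm_eq_zero : ∀ x ∈ carrier, (norm x = 0 ↔ x = 0)
  norm_smul : ∀ (c : ℝ), ∀ x ∈ carrier, norm (c • x) = |c| * norm x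
  norm_add_le : ∀ x ∈ carrier, ∀ y ∈ carrier, norm (x + y) ≤ norm x + norm y
  complete : ∀ u : ℕ → V, (∀ n, u n ∈ carrier) →
    (∀ ε > 0, ∃ N, ∀ m ≥ N, ∀ n ≥ N, norm (u m - u n) < ε) →
    ∃ v ∈ carrier, Filter.Tendsto (fun n => norm (u n - v)) Filter.atTop (𝓝 0)

section Interpolation

variable {V : Type*} [AddCommGroup V] [Module ℝ V]

/-- The linear operator `T` on `X₀ + X₁` maps each `Xⱼ` into itself with norm at most `c`. -/
def CoupleBound (X₀ X₁ : BanachSubspace V)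
    (T : ↥(X₀.carrier ⊔ X₁.carrier) →ₗ[ℝ] ↥(X₀.carrier ⊔ X₁.carrier)) (c : ℝ) : Prop :=
  (∀ x : ↥(X₀.carrier ⊔ X₁.carrier), (x : V) ∈ X₀.carrier →
    (T x : V) ∈ X₀.carrier ∧ X₀.norm (T x) ≤ c * X₀.norm x) ∧
  (∀ x : ↥(X₀.carrier ⊔ X₁.carrier), (x : V) ∈ X₁.carrier →
    (T x : V) ∈ X₁.carrier ∧ X₁.norm (T x) ≤ c * X₁.norm x)

/-- `T : (X₀, X₁) → (X₀, X₁)` is a linear operator whose norm (the larger of the norms of its two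
restrictions `Xⱼ → Xⱼ`) equals one. -/
def HasCoupleNormOne (X₀ X₁ : BanachSubspace V)
    (T : ↥(X₀.carrier ⊔ X₁.carrier) →ₗ[ℝ] ↥(X₀.carrier ⊔ X₁.carrier)) : Prop :=
  IsLeast {c : ℝ | 0 ≤ c ∧ CoupleBound X₀ X₁ T c} 1

/-- `X ∈ Int₁(X₀, X₁)`. -/
structure IsExactInterpolationSpace (X₀ X₁ X : BanachSubspace V) : Prop where
  inter_le : X₀.carrier ⊓ X₁.carrier ≤ X.carrier
  le_sum : X.carrier ≤ X₀.carrier ⊔ X₁.carrier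
  bound : ∀ T : ↥(X₀.carrier ⊔ X₁.carrier) →ₗ[ℝ] ↥(X₀.carrier ⊔ X₁.carrier),
    HasCoupleNormOne X₀ X₁ T →
    ∀ x : ↥(X₀.carrier ⊔ X₁.carrier), (x : V) ∈ X.carrier →
      (T x : V) ∈ X.carrier ∧ X.norm (T x) ≤ X.norm x

end Interpolation

/-- `L^p_μ`, `1 ≤ p ≤ ∞`, inside the space of `μ`-measurable functions modulo equality a.e. -/
def lebesgueSpace (p : ℝ≥0∞) [hp : Fact (1 ≤ p)] (μ : Measure ℝ) :
    BanachSubspace (ℝ →ₘ[μ] ℝ) where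
  carrier := Lp.LpSubmodule ℝ ℝ p μ
  norm f := (eLpNorm f p μ).toReal
  norm_nonneg _ _ := ENNReal.toReal_nonneg
  norm_eq_zero f hf := by
    have h := norm_eq_zero (a := (⟨f, hf⟩ : Lp ℝ p μ))
    rw [Lp.norm_def] at h
    exact h.trans ⟨fun e => congrArg Subtype.val e, fun e => Subtype.ext e⟩
  norm_smul c f hf := by
    have h := norm_smul c (⟨f, hf⟩ : Lp ℝ p μ)
    rw [Lp.norm_def, Lp.norm_def, Real.norm_eq_abs] at h
    exact h
  norm_add_le f hf g hg := by
    have h := norm_add_le (⟨f, hf⟩ : Lp ℝ p μ) ⟨g, hg⟩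
    rw [Lp.norm_def, Lp.norm_def, Lp.norm_def] at h
    exact h
  complete u hu hc := by
    have key : ∀ a b : Lp ℝ p μ,
        dist a b = (eLpNorm ((a : ℝ →ₘ[μ] ℝ) - (b : ℝ →ₘ[μ] ℝ) : ℝ →ₘ[μ] ℝ) p μ).toReal := by
      intro a b
      rw [dist_eq_norm, Lp.norm_def]
      rfl
    have hcs : CauchySeq (fun n => (⟨u n, hu n⟩ : Lp ℝ p μ)) := by
      rw [Metric.cauchySeq_iff]
      intro ε hε
      obtain ⟨N, hN⟩ := hc ε hε
      refine ⟨N, fun m hm n hn => ?_⟩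
      rw [key]
      exact hN m hm n hn
    obtain ⟨v, hv⟩ := cauchySeq_tendsto_of_complete hcs
    refine ⟨v, v.2, ?_⟩
    have h := tendsto_iff_dist_tendsto_zero.mp hv
    simp only [key] at h
    exact h

/-! ### The least decreasing majorant -/

/-- `f̃(x) = ess sup_μ {|f(y)| : y ≥ x}`. -/
def leastDecreasingMajorant (μ : Measure ℝ) (f : ℝ → ℝ) (x : ℝ) : ℝ≥0∞ :=
  essSup (fun y => ‖f y‖ₑ) (μ.restrict (Set.Ici x))

theorem leastDecreasingMajorant_antitone (μ : Measure ℝ) (f : ℝ → ℝ) :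
    Antitone (leastDecreasingMajorant μ f) := fun _ _ h =>
  essSup_mono_measure' (Measure.restrict_mono (Set.Ici_subset_Ici.mpr h) le_rfl)

theorem measurable_leastDecreasingMajorant (μ : Measure ℝ) (f : ℝ → ℝ) :
    Measurable (leastDecreasingMajorant μ f) :=
  (leastDecreasingMajorant_antitone μ f).measurable

/-! ### The level function -/

/-- `F` is `μ`-concave, with `Λ(x) = μ (-∞, x]`. -/
structure IsMeasureConcave (μ : Measure ℝ) (F : ℝ → ℝ) : Prop where
  nonneg : ∀ x, 0 ≤ F x
  aemeasurable : AEMeasurable F μ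
  concave : ∀ a x b : ℝ, a ≤ x → x ≤ b →
    (F b - F x) * (μ.real (Set.Iic x) - μ.real (Set.Iic a)) ≤
      (μ.real (Set.Iic b) - μ.real (Set.Iic x)) * (F x - F a)

/-- The (finite-valued) `μ`-concave majorants of `x ↦ ∫_{(-∞,x]} h dμ`. -/
def concaveMajorants (μ : Measure ℝ) (h : ℝ → ℝ≥0∞) : Set (ℝ → ℝ) :=
  {G | IsMeasureConcave μ G ∧ ∀ x, ∫⁻ y in Set.Iic x, h y ∂μ ≤ ENNReal.ofReal (G x)}

/-- The least `μ`-concave majorant of `x ↦ ∫_{(-∞,x]} h dμ`, as the pointwise infimum of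
all of them. -/
def leastConcaveMajorant (μ : Measure ℝ) (h : ℝ → ℝ≥0∞) (x : ℝ) : ℝ :=
  sInf ((fun G : ℝ → ℝ => G x) '' concaveMajorants μ h)

/-- `g` is a Radon–Nikodym derivative of the distribution function `G` with respect to `μ`. -/
def IsDensity (μ : Measure ℝ) (G : ℝ → ℝ) (g : ℝ → ℝ≥0∞) : Prop :=
  Measurable g ∧ ∀ x, ∫⁻ y in Set.Iic x, g y ∂μ = ENNReal.ofReal (G x)

open Classical in
/-- The Radon–Nikodym derivative of `G` with respect to `μ` (zero if there is none). -/
def density (μ : Measure ℝ) (G : ℝ → ℝ) : ℝ → ℝ≥0∞ :=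
  if h : ∃ g, IsDensity μ G g then h.choose else 0

theorem measurable_density (μ : Measure ℝ) (G : ℝ → ℝ) : Measurable (density μ G) := by
  unfold density
  split_ifs with h
  · exact h.choose_spec.1
  · exact measurable_zero

open Classical in
/-- The level function `f^o`: the Radon–Nikodym derivative of the least `μ`-concave majorant of
`x ↦ ∫_{(-∞,x]} |f| dμ` if that majorant is finite. Otherwise `f^o` is the increasing limit
of the level functions of the truncations `min(|f|, n)`; these have a finite majorant, namely
`n Λ`, whenever `Λ` is finite. -/
def levelFunction (μ : Measure ℝ) (f : ℝ → ℝ) : ℝ → ℝ≥0∞ :=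
  if (concaveMajorants μ (fun y => ‖f y‖ₑ)).Nonempty then
    density μ (leastConcaveMajorant μ (fun y => ‖f y‖ₑ))
  else
    fun x => ⨆ n : ℕ, density μ (leastConcaveMajorant μ (fun y => min ‖f y‖ₑ (n : ℝ≥0∞))) x

theorem measurable_levelFunction (μ : Measure ℝ) (f : ℝ → ℝ) :
    Measurable (levelFunction μ f) := by
  unfold levelFunction
  split_ifs
  · exact measurable_density _ _
  · exact Measurable.iSup fun n => measurable_density _ _

/-! ### The spaces built from the two constructions -/

/-- The class modulo equality a.e. of an a.e. finite `[0,∞]`-valued measurable function. -/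
def toClass (μ : Measure ℝ) (g : ℝ → ℝ≥0∞) (hg : Measurable g) : ℝ →ₘ[μ] ℝ :=
  AEEqFun.mk (fun x => (g x).toReal) hg.ennreal_toReal.aestronglyMeasurable

section Spaces

variable {μ : Measure ℝ}

/-- The set `X̃` of all `f` with `f̃ ∈ X`. -/
def tildeSpace (X : BanachSubspace (ℝ →ₘ[μ] ℝ)) : Set (ℝ →ₘ[μ] ℝ) :=
  {f | (∀ᵐ x ∂μ, leastDecreasingMajorant μ f x < ∞) ∧
    toClass μ (leastDecreasingMajorant μ f) (measurable_leastDecreasingMajorant μ f) ∈ X.carrier}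

/-- `‖f‖_{X̃} = ‖f̃‖_X`. -/
def tildeNorm (X : BanachSubspace (ℝ →ₘ[μ] ℝ)) (f : ℝ →ₘ[μ] ℝ) : ℝ :=
  X.norm (toClass μ (leastDecreasingMajorant μ f) (measurable_leastDecreasingMajorant μ f))

/-- The set `X^o` of all `f` with `f^o ∈ X`. -/
def levelSpace (X : BanachSubspace (ℝ →ₘ[μ] ℝ)) : Set (ℝ →ₘ[μ] ℝ) :=
  {f | (∀ᵐ x ∂μ, levelFunction μ f x < ∞) ∧
    toClass μ (levelFunction μ f) (measurable_levelFunction μ f) ∈ X.carrier}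

/-- `‖f‖_{X^o} = ‖f^o‖_X`. -/
def levelNorm (X : BanachSubspace (ℝ →ₘ[μ] ℝ)) (f : ℝ →ₘ[μ] ℝ) : ℝ :=
  X.norm (toClass μ (levelFunction μ f) (measurable_levelFunction μ f))

end Spaces

/-- The probability measure on `ℝ` with an atom of weight `2^{-k}` at `k`, for `k = 1, 2, 3, …`. -/
def dyadicMeasure : Measure ℝ :=
  Measure.sum fun k : ℕ+ => ((2 : ℝ≥0∞)⁻¹ ^ (k : ℕ)) • Measure.dirac ((k : ℕ) : ℝ)

end

/-! The first atom carries half of the total mass, and both constructions already reveal their full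
size there. Write `I` for the integral of `|f|`. The value of `f̃` at `1` is the `L^∞` norm of `f`,
and it dominates `f̃` at the later atoms. For the level function, concavity together with `Λ(1) =
1/2` forces every concave majorant `G` to satisfy `I ≤ 2 G(1)`, so `f^o(1) ≥ I`
(`lintegral_le_density_one`). Conversely `2 I Λ` is a concave majorant, and comparing slopes gives
`f^o ≤ 2 I` at every atom (`density_le_two_mul_lintegral`). If `I = ∞`, then `f^o(1) = ∞`.

Thus each construction produces a function `g` with `N ≤ g(1)` and `g ≤ 2 N` at the atoms, where `N`
is the `L^∞` or the `L^1` norm of `f`. No exact interpolation space can distinguish such a `g` from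
a constant of size `N` (`IsExactInterpolationSpace.toClass_mem`): multiplication operators bound its
norm above by `2 N ‖1‖_X` and below by `N` times the norm of the characteristic function of `{1}`.
-/

/-! ### Integration against the dyadic measure. -/

theorem ae_dyadicMeasure_iff {p : ℝ → Prop} :
    (∀ᵐ x ∂dyadicMeasure, p x) ↔ ∀ k : ℕ, p ((k + 1 : ℕ) : ℝ) := by
  have h : ∀ k : ℕ+, (∀ᵐ x ∂(((2 : ℝ≥0∞)⁻¹ ^ (k : ℕ)) • Measure.dirac ((k : ℕ) : ℝ)), p x) ↔
      p ((k : ℕ) : ℝ) := by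
    intro k
    rw [Measure.ae_ennreal_smul_measure_iff (pow_ne_zero _ (by simp)), ae_dirac_eq,
      Filter.eventually_pure]
  unfold dyadicMeasure
  rw [Measure.ae_sum_iff]
  simp only [h]
  exact ⟨fun H k => H k.succPNat, fun H k => by
    have := H k.natPred
    rwa [PNat.natPred_add_one] at this⟩

theorem lintegral_dyadicMeasure (h : ℝ → ℝ≥0∞) :
    ∫⁻ y, h y ∂dyadicMeasure = ∑' k : ℕ, (2 : ℝ≥0∞)⁻¹ ^ (k + 1) * h ((k + 1 : ℕ) : ℝ) := by
  unfold dyadicMeasure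
  simp only [lintegral_sum_measure, lintegral_smul_measure, lintegral_dirac, smul_eq_mul]
  exact tsum_pnat_eq_tsum_succ (f := fun k : ℕ => (2 : ℝ≥0∞)⁻¹ ^ k * h (k : ℝ))

theorem setLIntegral_Iic_dyadicMeasure (h : ℝ → ℝ≥0∞) (x : ℝ) :
    ∫⁻ y in Set.Iic x, h y ∂dyadicMeasure =
      ∑ k ∈ Finset.range ⌊x⌋₊, (2 : ℝ≥0∞)⁻¹ ^ (k + 1) * h ((k + 1 : ℕ) : ℝ) := by
  rw [← lintegral_indicator measurableSet_Iic, lintegral_dyadicMeasure, tsum_eq_sum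
    (s := Finset.range ⌊x⌋₊)]
  · refine Finset.sum_congr rfl fun k hk => ?_
    have hk' : ((k + 1 : ℕ) : ℝ) ≤ x :=
      (Nat.le_floor_iff' k.succ_ne_zero).1 (Finset.mem_range.1 hk)
    rw [Set.indicator_of_mem (show ((k + 1 : ℕ) : ℝ) ∈ Set.Iic x from hk')]
  · intro k hk
    have hk' : ¬ ((k + 1 : ℕ) : ℝ) ≤ x := fun H =>
      hk (Finset.mem_range.2 ((Nat.le_floor_iff' k.succ_ne_zero).2 H))
    rw [Set.indicator_of_notMem (show ((k + 1 : ℕ) : ℝ) ∉ Set.Iic x from hk'), mul_zero]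

theorem setLIntegral_Iic_dyadicMeasure_succ (h : ℝ → ℝ≥0∞) (k : ℕ) :
    ∫⁻ y in Set.Iic ((k + 1 : ℕ) : ℝ), h y ∂dyadicMeasure =
      ∫⁻ y in Set.Iic (k : ℝ), h y ∂dyadicMeasure +
        (2 : ℝ≥0∞)⁻¹ ^ (k + 1) * h ((k + 1 : ℕ) : ℝ) := by
  simp only [setLIntegral_Iic_dyadicMeasure, Nat.floor_natCast, Finset.sum_range_succ]

theorem lintegral_dyadicMeasure_le {h : ℝ → ℝ≥0∞} {c : ℝ≥0∞}
    (H : ∀ n : ℕ, ∫⁻ y in Set.Iic ((n + 1 : ℕ) : ℝ), h y ∂dyadicMeasure ≤ c) :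
    ∫⁻ y, h y ∂dyadicMeasure ≤ c := by
  rw [lintegral_dyadicMeasure]
  refine ENNReal.tsum_le_of_sum_range_le fun n => ?_
  have := H n
  rw [setLIntegral_Iic_dyadicMeasure_succ, setLIntegral_Iic_dyadicMeasure, Nat.floor_natCast]
    at this
  exact le_self_add.trans this

/-- The natural floor is `0` for every `x < 1`, including negative `x`, so a single formula covers
the whole line. -/
theorem dyadicMeasure_Iic (x : ℝ) :
    dyadicMeasure.real (Set.Iic x) = 1 - 2⁻¹ ^ ⌊x⌋₊ := by
  rw [Measure.real, ← setLIntegral_one, setLIntegral_Iic_dyadicMeasure,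
    ENNReal.toReal_sum (fun k _ => by simp)]
  simp only [mul_one, ENNReal.toReal_pow, ENNReal.toReal_inv, ENNReal.toReal_ofNat]
  induction ⌊x⌋₊ with
  | zero => simp
  | succ n ih => rw [Finset.sum_range_succ, ih]; ring

theorem dyadicMeasure_Iic_natCast (n : ℕ) :
    dyadicMeasure.real (Set.Iic (n : ℝ)) = 1 - 2⁻¹ ^ n := by
  rw [dyadicMeasure_Iic, Nat.floor_natCast]

instance : IsProbabilityMeasure dyadicMeasure where
  measure_univ := by
    rw [← lintegral_one, lintegral_dyadicMeasure]
    simp only [mul_one]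
    rw [ENNReal.tsum_geometric_add_one, ENNReal.one_sub_inv_two, inv_inv,
      ENNReal.inv_mul_cancel (by simp) (by simp)]

/-! ### Level functions -/

section Level

variable {h : ℝ → ℝ≥0∞}

/-- Past `1` the slope with respect to `Λ` is at most `(G 1 - G 0) / (1/2) ≤ 2 * G 1`, and less than
`1/2` of `Λ` remains to be gained. -/
theorem IsMeasureConcave.natCast_le_two_mul {G : ℝ → ℝ} (hG : IsMeasureConcave dyadicMeasure G)
    (n : ℕ) : G ((n + 1 : ℕ) : ℝ) ≤ 2 * G 1 := by
  have h1 := hG.concave (0 : ℕ) (1 : ℕ) (n + 1 : ℕ) (by simp) (by simp)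
  simp only [dyadicMeasure_Iic_natCast] at h1
  have h0 := hG.nonneg (0 : ℕ)
  have h2 := hG.nonneg (1 : ℕ)
  have h3 : (0 : ℝ) < 2⁻¹ ^ (n + 1) := by positivity
  have h4 : (2⁻¹ : ℝ) ^ (n + 1) ≤ 2⁻¹ ^ 1 := pow_le_pow_of_le_one (by norm_num) (by norm_num)
    (by omega)
  simp only [Nat.cast_one, Nat.cast_zero, pow_zero, pow_one] at *
  nlinarith

theorem lintegral_le_of_mem_concaveMajorants {G : ℝ → ℝ}
    (hG : G ∈ concaveMajorants dyadicMeasure h) :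
    ∫⁻ y, h y ∂dyadicMeasure ≤ ENNReal.ofReal (2 * G 1) :=
  lintegral_dyadicMeasure_le fun n =>
    (hG.2 _).trans (ENNReal.ofReal_le_ofReal (hG.1.natCast_le_two_mul n))

/-- A multiple of `Λ` satisfies the concavity condition with equality. The factor `2` suffices
because `Λ ≥ 1/2` from the first atom on, while the integral vanishes before it. -/
theorem two_mul_mem_concaveMajorants (hh : ∫⁻ y, h y ∂dyadicMeasure ≠ ∞) :
    (fun x => 2 * (∫⁻ y, h y ∂dyadicMeasure).toReal * dyadicMeasure.real (Set.Iic x)) ∈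
      concaveMajorants dyadicMeasure h := by
  refine ⟨⟨fun x => by positivity, ?_, fun a x b _ _ => le_of_eq (by ring)⟩, fun x => ?_⟩
  · refine (Measurable.const_mul (Monotone.measurable fun a b hab => ?_) _).aemeasurable
    exact measureReal_mono (Set.Iic_subset_Iic.2 hab)
  · rcases Nat.eq_zero_or_pos ⌊x⌋₊ with h0 | h0
    · rw [setLIntegral_Iic_dyadicMeasure, h0]; simp
    · refine (setLIntegral_le_lintegral _ _).trans ?_
      refine (ENNReal.le_ofReal_iff_toReal_le hh (by positivity)).2 ?_
      simp only [dyadicMeasure_Iic]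
      have h4 : (2⁻¹ : ℝ) ^ ⌊x⌋₊ ≤ 2⁻¹ ^ 1 := pow_le_pow_of_le_one (by norm_num) (by norm_num) h0
      have := ENNReal.toReal_nonneg (a := ∫⁻ y, h y ∂dyadicMeasure)
      nlinarith

theorem const_mem_concaveMajorants {μ : Measure ℝ} {c : ℝ} (hc : 0 ≤ c)
    (H : ∀ x, ∫⁻ y in Set.Iic x, h y ∂μ ≤ ENNReal.ofReal c) :
    (fun _ => c) ∈ concaveMajorants μ h :=
  ⟨⟨fun _ => hc, aemeasurable_const, fun _ _ _ _ _ => by simp⟩, H⟩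

theorem leastConcaveMajorant_le {μ : Measure ℝ} {G : ℝ → ℝ} (hG : G ∈ concaveMajorants μ h)
    (x : ℝ) : leastConcaveMajorant μ h x ≤ G x :=
  csInf_le ⟨0, by rintro _ ⟨F, hF, rfl⟩; exact hF.1.nonneg x⟩ ⟨G, hG, rfl⟩

theorem le_leastConcaveMajorant {μ : Measure ℝ} (hne : (concaveMajorants μ h).Nonempty)
    {x c : ℝ} (H : ∀ G ∈ concaveMajorants μ h, c ≤ G x) : c ≤ leastConcaveMajorant μ h x :=
  le_csInf (hne.image _) (by rintro _ ⟨G, hG, rfl⟩; exact H G hG)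

/-- An infimum of concave functions is concave: when `Λ(a) < Λ(x)`, the chord value for the infimum
lies below that for each majorant. If `Λ(a) = Λ(x)`, no chord is available and only monotonicity
across a null interval is needed. -/
theorem leastConcaveMajorant_concave {μ : Measure ℝ} [IsFiniteMeasure μ]
    (hne : (concaveMajorants μ h).Nonempty) {a x b : ℝ} (hax : a ≤ x) (hxb : x ≤ b) :
    (leastConcaveMajorant μ h b - leastConcaveMajorant μ h x) *
        (μ.real (Set.Iic x) - μ.real (Set.Iic a)) ≤
      (μ.real (Set.Iic b) - μ.real (Set.Iic x)) *
        (leastConcaveMajorant μ h x - leastConcaveMajorant μ h a) := by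
  have hm : Monotone fun x => μ.real (Set.Iic x) := fun a b hab =>
    measureReal_mono (Set.Iic_subset_Iic.2 hab)
  set A := μ.real (Set.Iic a) with hA
  set Y := μ.real (Set.Iic x) with hY
  set B := μ.real (Set.Iic b) with hB
  have hAY : A ≤ Y := hm hax
  have hYB : Y ≤ B := hm hxb
  rcases hAY.eq_or_lt with e1 | l1
  · rcases hYB.eq_or_lt with e2 | l2
    · rw [e1, e2]; simp
    · rw [e1, sub_self, mul_zero]
      refine mul_nonneg (sub_nonneg.2 hYB) (sub_nonneg.2 (le_leastConcaveMajorant hne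
        fun G hG => (leastConcaveMajorant_le hG a).trans ?_))
      have := hG.1.concave a x b hax hxb
      rw [← hA, ← hY, ← hB, e1, sub_self, mul_zero] at this
      exact sub_nonneg.1 (nonneg_of_mul_nonneg_right this (sub_pos.2 l2))
  · have key : (leastConcaveMajorant μ h a * (B - Y) + leastConcaveMajorant μ h b * (Y - A)) /
        (B - A) ≤ leastConcaveMajorant μ h x := by
      refine le_leastConcaveMajorant hne fun G hG => ?_
      rw [div_le_iff₀ (by linarith)]
      have h1 := hG.1.concave a x b hax hxb
      rw [← hA, ← hY, ← hB] at h1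
      have h2 := mul_le_mul_of_nonneg_right (leastConcaveMajorant_le hG a) (sub_nonneg.2 hYB)
      have h3 := mul_le_mul_of_nonneg_right (leastConcaveMajorant_le hG b) (sub_nonneg.2 hAY)
      linarith
    rw [div_le_iff₀ (by linarith)] at key
    linarith

theorem leastConcaveMajorant_nonneg {μ : Measure ℝ} (x : ℝ) : 0 ≤ leastConcaveMajorant μ h x :=
  Real.sInf_nonneg (by rintro _ ⟨G, hG, rfl⟩; exact hG.1.nonneg x)

theorem leastConcaveMajorant_zero (hh : ∫⁻ y, h y ∂dyadicMeasure ≠ ∞) {x : ℝ} (hx : ⌊x⌋₊ = 0) :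
    leastConcaveMajorant dyadicMeasure h x = 0 := by
  refine le_antisymm ?_ (leastConcaveMajorant_nonneg x)
  refine (leastConcaveMajorant_le (two_mul_mem_concaveMajorants hh) x).trans_eq ?_
  rw [dyadicMeasure_Iic, hx]; simp

/-- An individual majorant may decrease, since nonnegativity and concavity in `Λ ∈ [0, 1)` do not
imply monotonicity. But if `G` drops from `k` to `k + 1`, it never again exceeds `G (k + 1)`, so
that constant is itself a smaller majorant. -/
theorem leastConcaveMajorant_le_succ (hh : ∫⁻ y, h y ∂dyadicMeasure ≠ ∞) (k : ℕ) :
    leastConcaveMajorant dyadicMeasure h k ≤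
      leastConcaveMajorant dyadicMeasure h ((k + 1 : ℕ) : ℝ) := by
  refine le_leastConcaveMajorant ⟨_, two_mul_mem_concaveMajorants hh⟩ fun G hG => ?_
  rcases le_or_gt (G k) (G ((k + 1 : ℕ) : ℝ)) with hle | hlt
  · exact (leastConcaveMajorant_le hG k).trans hle
  refine leastConcaveMajorant_le (const_mem_concaveMajorants (hG.1.nonneg _) fun x => ?_) (k : ℝ)
  -- Only points from `k + 1` on are controlled by `G (k + 1)`; monotonicity of the integral reduces
  -- every other `x` to these.
  have hxz : x ≤ max x ((k + 1 : ℕ) : ℝ) := le_max_left _ _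
  refine (lintegral_mono_set (Set.Iic_subset_Iic.2 hxz)).trans
    ((hG.2 _).trans (ENNReal.ofReal_le_ofReal ?_))
  set z := max x ((k + 1 : ℕ) : ℝ) with hz
  have hkz : ((k + 1 : ℕ) : ℝ) ≤ z := le_max_right _ _
  have h1 := hG.1.concave k (k + 1 : ℕ) z (by simp) hkz
  have h2 : dyadicMeasure.real (Set.Iic ((k + 1 : ℕ) : ℝ)) ≤ dyadicMeasure.real (Set.Iic z) :=
    measureReal_mono (Set.Iic_subset_Iic.2 hkz)
  have h3 : dyadicMeasure.real (Set.Iic (k : ℝ)) <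
      dyadicMeasure.real (Set.Iic ((k + 1 : ℕ) : ℝ)) := by
    rw [dyadicMeasure_Iic_natCast, dyadicMeasure_Iic_natCast, pow_succ]
    have : (0 : ℝ) < 2⁻¹ ^ k := by positivity
    linarith
  nlinarith

/-- A density must reproduce the majorant at every real `x`, so the majorant has to be constant
between atoms. Concavity forces this once there is positive mass on both sides; before the first
atom the bound by `2 I Λ = 0` replaces it. -/
theorem leastConcaveMajorant_floor (hh : ∫⁻ y, h y ∂dyadicMeasure ≠ ∞) (x : ℝ) :
    leastConcaveMajorant dyadicMeasure h (⌊x⌋₊ : ℝ) = leastConcaveMajorant dyadicMeasure h x := by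
  have hne : (concaveMajorants dyadicMeasure h).Nonempty := ⟨_, two_mul_mem_concaveMajorants hh⟩
  rcases Nat.eq_zero_or_pos ⌊x⌋₊ with h0 | h0
  · rw [leastConcaveMajorant_zero hh h0, leastConcaveMajorant_zero hh (by simp [h0])]
  have hx : (⌊x⌋₊ : ℝ) ≤ x := Nat.floor_le (Nat.pos_of_floor_pos h0).le
  have hx' : x ≤ ((⌊x⌋₊ + 1 : ℕ) : ℝ) := by push_cast; exact (Nat.lt_floor_add_one x).le
  have hp : (0 : ℝ) < 2⁻¹ ^ ⌊x⌋₊ := by positivity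
  have hp1 : (2⁻¹ : ℝ) ^ ⌊x⌋₊ < 1 := pow_lt_one₀ (by norm_num) (by norm_num) h0.ne'
  apply le_antisymm
  · have := leastConcaveMajorant_concave hne hx hx'
    rw [dyadicMeasure_Iic_natCast, dyadicMeasure_Iic_natCast, dyadicMeasure_Iic, sub_self,
      mul_zero, pow_succ] at this
    exact sub_nonneg.1 (nonneg_of_mul_nonneg_right this (by linarith))
  · have := leastConcaveMajorant_concave hne (Nat.cast_nonneg (α := ℝ) ⌊x⌋₊) hx
    rw [dyadicMeasure_Iic_natCast, dyadicMeasure_Iic x, sub_self, zero_mul, dyadicMeasure_Iic,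
      Nat.floor_zero, pow_zero, sub_self, sub_zero] at this
    exact sub_nonpos.1 (nonpos_of_mul_nonpos_left this (by linarith))

/-! ### Existence and size of the density. -/

theorem exists_isDensity_leastConcaveMajorant (hh : ∫⁻ y, h y ∂dyadicMeasure ≠ ∞) :
    ∃ g, IsDensity dyadicMeasure (leastConcaveMajorant dyadicMeasure h) g := by
  set K := leastConcaveMajorant dyadicMeasure h with hK
  -- At the atom `n` this is the jump of `K` divided by the mass `2^{-n}`. The truncated subtraction
  -- at floor `0` is harmless, as there is no atom there.
  refine ⟨fun x => 2 ^ ⌊x⌋₊ * ENNReal.ofReal (K (⌊x⌋₊ : ℝ) - K ((⌊x⌋₊ - 1 : ℕ) : ℝ)),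
    (measurable_from_nat (f := fun n : ℕ =>
      2 ^ n * ENNReal.ofReal (K (n : ℝ) - K ((n - 1 : ℕ) : ℝ)))).comp Nat.measurable_floor,
    fun x => ?_⟩
  rw [setLIntegral_Iic_dyadicMeasure, hK, ← leastConcaveMajorant_floor hh x, ← hK]
  induction ⌊x⌋₊ with
  | zero =>
    rw [hK, leastConcaveMajorant_zero hh (by simp)]; simp
  | succ n ih =>
    rw [Finset.sum_range_succ, ih, Nat.floor_natCast, Nat.add_sub_cancel, ← mul_assoc,
      ← mul_pow, ENNReal.inv_mul_cancel (by simp) (by simp), one_pow, one_mul,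
      ← ENNReal.ofReal_add (leastConcaveMajorant_nonneg _)
        (sub_nonneg.2 (leastConcaveMajorant_le_succ hh n)), add_sub_cancel]

theorem isDensity_density {μ : Measure ℝ} {G : ℝ → ℝ} (H : ∃ g, IsDensity μ G g) :
    IsDensity μ G (density μ G) := by
  rw [density, dif_pos H]; exact H.choose_spec

theorem lintegral_le_density_one (hh : ∫⁻ y, h y ∂dyadicMeasure ≠ ∞) :
    ∫⁻ y, h y ∂dyadicMeasure ≤ density dyadicMeasure (leastConcaveMajorant dyadicMeasure h) 1 := by
  have hd := (isDensity_density (exists_isDensity_leastConcaveMajorant hh)).2 1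
  rw [setLIntegral_Iic_dyadicMeasure] at hd
  simp only [Nat.floor_one, Finset.sum_range_one, zero_add, pow_one, Nat.cast_one] at hd
  have h1 : (∫⁻ y, h y ∂dyadicMeasure).toReal / 2 ≤ leastConcaveMajorant dyadicMeasure h 1 := by
    refine le_leastConcaveMajorant ⟨_, two_mul_mem_concaveMajorants hh⟩ fun G hG => ?_
    have := ENNReal.toReal_le_of_le_ofReal (by linarith [hG.1.nonneg 1])
      (lintegral_le_of_mem_concaveMajorants hG)
    linarith
  have h2 := ENNReal.ofReal_le_ofReal h1
  rw [← hd, ENNReal.ofReal_div_of_pos (by norm_num), ENNReal.ofReal_toReal hh, div_eq_mul_inv,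
    mul_comm, ENNReal.ofReal_ofNat] at h2
  exact (ENNReal.mul_le_mul_iff_right (a := 2⁻¹) (by simp) (by simp)).1 h2

theorem density_le_two_mul_lintegral (hh : ∫⁻ y, h y ∂dyadicMeasure ≠ ∞) (k : ℕ) :
    density dyadicMeasure (leastConcaveMajorant dyadicMeasure h) ((k + 1 : ℕ) : ℝ) ≤
      2 * ∫⁻ y, h y ∂dyadicMeasure := by
  have hd := (isDensity_density (exists_isDensity_leastConcaveMajorant hh)).2
  have hne : (concaveMajorants dyadicMeasure h).Nonempty := ⟨_, two_mul_mem_concaveMajorants hh⟩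
  have h1 := setLIntegral_Iic_dyadicMeasure_succ
    (density dyadicMeasure (leastConcaveMajorant dyadicMeasure h)) k
  rw [hd, hd] at h1
  set I := (∫⁻ y, h y ∂dyadicMeasure).toReal with hI
  have hI0 : 0 ≤ I := ENNReal.toReal_nonneg
  have h2 : leastConcaveMajorant dyadicMeasure h ((k + 1 : ℕ) : ℝ) ≤
      leastConcaveMajorant dyadicMeasure h k + 2⁻¹ ^ (k + 1) * (2 * I) := by
    have hb := fun n : ℕ => leastConcaveMajorant_le (two_mul_mem_concaveMajorants hh) (n : ℝ)
    simp only [dyadicMeasure_Iic_natCast] at hb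
    -- For `k > 0` the slope after `k` is at most the chord slope `K(k) / Λ(k) ≤ 2 I`; at `k = 0`
    -- the divisor `Λ(0)` vanishes, so `K(1) ≤ 2 I Λ(1)` is used directly.
    rcases Nat.eq_zero_or_pos k with rfl | hk
    · rw [leastConcaveMajorant_zero hh (x := ((0 : ℕ) : ℝ)) (by simp)]
      have := hb 1
      norm_num at this ⊢
      linarith
    · have hc := leastConcaveMajorant_concave hne (Nat.cast_nonneg (α := ℝ) k)
        (Nat.cast_le (α := ℝ).2 k.le_succ)
      rw [leastConcaveMajorant_zero hh (x := 0) (by simp), sub_zero,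
        ← Nat.cast_zero (R := ℝ)] at hc
      simp only [dyadicMeasure_Iic_natCast, pow_zero, sub_self, sub_zero, Nat.succ_eq_add_one] at hc
      have hp1 : (2⁻¹ : ℝ) ^ k < 1 := pow_lt_one₀ (by norm_num) (by norm_num) hk.ne'
      have hp : (0 : ℝ) < 2⁻¹ ^ (k + 1) := by positivity
      have hs : (1 : ℝ) - 2⁻¹ ^ (k + 1) - (1 - 2⁻¹ ^ k) = 2⁻¹ ^ (k + 1) := by ring
      rw [hs] at hc
      have h3 := hc.trans (mul_le_mul_of_nonneg_left (hb k) hp.le)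
      rw [← hI, ← mul_assoc] at h3
      linarith [le_of_mul_le_mul_right h3 (by linarith)]
  have h3 := ENNReal.ofReal_le_ofReal h2
  rw [h1, ENNReal.ofReal_add (leastConcaveMajorant_nonneg _) (by positivity),
    ENNReal.ofReal_mul (by positivity), ENNReal.ofReal_mul (by positivity), hI,
    ENNReal.ofReal_toReal hh, ENNReal.ofReal_pow (by positivity),
    ENNReal.ofReal_inv_of_pos (by norm_num), ENNReal.ofReal_ofNat,
    ENNReal.add_le_add_iff_left ENNReal.ofReal_ne_top] at h3
  exact (ENNReal.mul_le_mul_iff_right (pow_ne_zero _ (by simp)) (by simp)).1 h3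

theorem levelFunction_of_lintegral_ne_top {f : ℝ → ℝ} (hf : ∫⁻ y, ‖f y‖ₑ ∂dyadicMeasure ≠ ∞) :
    levelFunction dyadicMeasure f =
      density dyadicMeasure (leastConcaveMajorant dyadicMeasure fun y => ‖f y‖ₑ) :=
  if_pos ⟨_, two_mul_mem_concaveMajorants hf⟩

/-- A finite majorant would bound the integral, so the truncation branch applies. Each truncation
has level function at `1` at least its own integral, and these integrals tend to `∞` by monotone
convergence. -/
theorem levelFunction_one_of_lintegral_eq_top {f : ℝ → ℝ} (hfm : Measurable f)
    (hf : ∫⁻ y, ‖f y‖ₑ ∂dyadicMeasure = ∞) : levelFunction dyadicMeasure f 1 = ∞ := by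
  have hne : ¬ (concaveMajorants dyadicMeasure fun y => ‖f y‖ₑ).Nonempty := by
    rintro ⟨G, hG⟩
    have := lintegral_le_of_mem_concaveMajorants hG
    rw [hf] at this
    exact ENNReal.ofReal_ne_top (top_le_iff.1 this)
  have hfin : ∀ n : ℕ, ∫⁻ y, min ‖f y‖ₑ (n : ℝ≥0∞) ∂dyadicMeasure ≠ ∞ := fun n =>
    ne_top_of_le_ne_top (by simp) (lintegral_mono fun y => min_le_right _ (n : ℝ≥0∞))
  have hsup : ∀ y, ⨆ n : ℕ, min ‖f y‖ₑ (n : ℝ≥0∞) = ‖f y‖ₑ := fun y => by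
    exact (inf_iSup_eq _ _).symm.trans (by rw [ENNReal.iSup_natCast, inf_top_eq])
  rw [levelFunction, if_neg hne, ← top_le_iff, ← hf]
  calc ∫⁻ y, ‖f y‖ₑ ∂dyadicMeasure
      = ⨆ n : ℕ, ∫⁻ y, min ‖f y‖ₑ (n : ℝ≥0∞) ∂dyadicMeasure := by
        rw [← lintegral_iSup (fun n => hfm.enorm.min measurable_const)
          (fun m n hmn y => min_le_min_left _ (Nat.cast_le.2 hmn))]
        simp only [hsup]
    _ ≤ _ := iSup_mono fun n => lintegral_le_density_one (hfin n)

end Level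

/-! ### Multiplication operators on exact interpolation spaces -/

section Multiplication

variable {μ : Measure ℝ}

theorem mem_lebesgueSpace_iff {p : ℝ≥0∞} [Fact (1 ≤ p)] {f : ℝ →ₘ[μ] ℝ} :
    f ∈ (lebesgueSpace p μ).carrier ↔ eLpNorm f p μ < ∞ :=
  Lp.mem_Lp_iff_eLpNorm_lt_top

theorem lebesgueSpace_norm (p : ℝ≥0∞) [Fact (1 ≤ p)] (f : ℝ →ₘ[μ] ℝ) :
    (lebesgueSpace p μ).norm f = (eLpNorm f p μ).toReal := rfl

/-- Multiplication by a class of measurable functions. -/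
noncomputable def mulOperator (m : ℝ →ₘ[μ] ℝ) : (ℝ →ₘ[μ] ℝ) →ₗ[ℝ] (ℝ →ₘ[μ] ℝ) where
  toFun f := m * f
  map_add' f g := by
    refine AEEqFun.ext ?_
    filter_upwards [AEEqFun.coeFn_mul m (f + g), AEEqFun.coeFn_add f g,
      AEEqFun.coeFn_add (m * f) (m * g), AEEqFun.coeFn_mul m f, AEEqFun.coeFn_mul m g]
      with x h1 h2 h3 h4 h5
    simp only [h1, h2, h3, h4, h5, Pi.mul_apply, Pi.add_apply, mul_add]
  map_smul' c f := by
    refine AEEqFun.ext ?_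
    filter_upwards [AEEqFun.coeFn_mul m (c • f), AEEqFun.coeFn_smul c f,
      AEEqFun.coeFn_smul c (m * f), AEEqFun.coeFn_mul m f] with x h1 h2 h3 h4
    simp only [h1, h2, h3, h4, Pi.mul_apply, Pi.smul_apply, smul_eq_mul, RingHom.id_apply]
    ring

theorem eLpNorm_mul_le_of_eLpNorm_top_le_one {m : ℝ →ₘ[μ] ℝ} (hm : eLpNorm m ∞ μ ≤ 1)
    (f : ℝ →ₘ[μ] ℝ) (p : ℝ≥0∞) : eLpNorm (m * f : ℝ →ₘ[μ] ℝ) p μ ≤ eLpNorm f p μ := by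
  rw [eLpNorm_congr_ae (AEEqFun.coeFn_mul m f)]
  refine (eLpNorm_smul_le_eLpNorm_top_mul_eLpNorm p f.aestronglyMeasurable m).trans ?_
  exact (mul_le_mul_left hm _).trans_eq (one_mul _)

theorem mul_mem_lebesgueSpace {m : ℝ →ₘ[μ] ℝ} (hm : eLpNorm m ∞ μ ≤ 1) {p : ℝ≥0∞}
    [Fact (1 ≤ p)] {f : ℝ →ₘ[μ] ℝ} (hf : f ∈ (lebesgueSpace p μ).carrier) :
    m * f ∈ (lebesgueSpace p μ).carrier ∧
      (lebesgueSpace p μ).norm (m * f) ≤ 1 * (lebesgueSpace p μ).norm f := by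
  rw [mem_lebesgueSpace_iff] at hf ⊢
  have h := eLpNorm_mul_le_of_eLpNorm_top_le_one hm f p
  rw [one_mul]
  exact ⟨h.trans_lt hf, ENNReal.toReal_mono hf.ne h⟩

theorem eLpNorm_top_one [IsProbabilityMeasure μ] : eLpNorm (1 : ℝ →ₘ[μ] ℝ) ∞ μ = 1 := by
  rw [eLpNorm_congr_ae AEEqFun.coeFn_one]
  exact (eLpNorm_const (1 : ℝ) (by simp) (NeZero.ne μ)).trans (by simp)

theorem one_mem_lebesgueSpace_top [IsProbabilityMeasure μ] :
    (1 : ℝ →ₘ[μ] ℝ) ∈ (lebesgueSpace ∞ μ).carrier := by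
  rw [mem_lebesgueSpace_iff, eLpNorm_top_one]; exact ENNReal.one_lt_top

/-- The interpolation property concerns operators of norm exactly one, hence the equality required
of `m`; testing on the constant `1` shows that the norm is not smaller. -/
theorem IsExactInterpolationSpace.mul_mem [IsProbabilityMeasure μ]
    {X : BanachSubspace (ℝ →ₘ[μ] ℝ)}
    (hX : IsExactInterpolationSpace (lebesgueSpace 1 μ) (lebesgueSpace ∞ μ) X)
    {m : ℝ →ₘ[μ] ℝ} (hm : eLpNorm m ∞ μ = 1) {f : ℝ →ₘ[μ] ℝ} (hf : f ∈ X.carrier) :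
    m * f ∈ X.carrier ∧ X.norm (m * f) ≤ X.norm f := by
  have hmap : ∀ x ∈ (lebesgueSpace 1 μ).carrier ⊔ (lebesgueSpace ∞ μ).carrier,
      mulOperator m x ∈ (lebesgueSpace 1 μ).carrier ⊔ (lebesgueSpace ∞ μ).carrier := by
    intro x hx
    obtain ⟨y, hy, z, hz, rfl⟩ := Submodule.mem_sup.1 hx
    rw [map_add]
    exact Submodule.add_mem_sup (mul_mem_lebesgueSpace hm.le hy).1
      (mul_mem_lebesgueSpace hm.le hz).1
  have hone := one_mem_lebesgueSpace_top (μ := μ)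
  refine hX.bound ((mulOperator m).restrict hmap) ⟨⟨zero_le_one, ?_, ?_⟩, ?_⟩
    ⟨f, hX.le_sum hf⟩ hf
  · exact fun x hx => mul_mem_lebesgueSpace hm.le hx
  · exact fun x hx => mul_mem_lebesgueSpace hm.le hx
  · rintro c ⟨_, -, hc⟩
    have h : (lebesgueSpace ∞ μ).norm (m * 1) ≤ c * (lebesgueSpace ∞ μ).norm 1 :=
      (hc ⟨1, Submodule.mem_sup_right hone⟩ hone).2
    rwa [mul_one, lebesgueSpace_norm, lebesgueSpace_norm, eLpNorm_top_one, hm,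
      ENNReal.toReal_one, mul_one] at h

theorem mem_lebesgueSpace_one_of_mem_top [IsProbabilityMeasure μ] {f : ℝ →ₘ[μ] ℝ}
    (hf : f ∈ (lebesgueSpace ∞ μ).carrier) : f ∈ (lebesgueSpace 1 μ).carrier := by
  rw [mem_lebesgueSpace_iff] at hf ⊢
  exact (eLpNorm_le_eLpNorm_of_exponent_le le_top f.aestronglyMeasurable).trans_lt hf

theorem IsExactInterpolationSpace.mem_of_mem_top [IsProbabilityMeasure μ]
    {X : BanachSubspace (ℝ →ₘ[μ] ℝ)}
    (hX : IsExactInterpolationSpace (lebesgueSpace 1 μ) (lebesgueSpace ∞ μ) X)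
    {f : ℝ →ₘ[μ] ℝ} (hf : f ∈ (lebesgueSpace ∞ μ).carrier) : f ∈ X.carrier :=
  hX.inter_le ⟨mem_lebesgueSpace_one_of_mem_top hf, hf⟩

/-- For `f ≠ 0`, the normalized function `f / ‖f‖_∞` is an admissible multiplier, applied to the
constant `1`. -/
theorem IsExactInterpolationSpace.norm_le_mul_norm_one [IsProbabilityMeasure μ]
    {X : BanachSubspace (ℝ →ₘ[μ] ℝ)}
    (hX : IsExactInterpolationSpace (lebesgueSpace 1 μ) (lebesgueSpace ∞ μ) X)
    {f : ℝ →ₘ[μ] ℝ} (hf : f ∈ (lebesgueSpace ∞ μ).carrier) :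
    X.norm f ≤ (lebesgueSpace ∞ μ).norm f * X.norm 1 := by
  have h1 := hX.mem_of_mem_top one_mem_lebesgueSpace_top
  set N := (lebesgueSpace ∞ μ).norm f with hN
  have hN0 : 0 ≤ N := (lebesgueSpace ∞ μ).norm_nonneg f hf
  rcases hN0.eq_or_lt with h0 | hpos
  · have hf0 : f = 0 := ((lebesgueSpace ∞ μ).norm_eq_zero f hf).1 h0.symm
    rw [← h0, zero_mul, hf0, (X.norm_eq_zero 0 X.carrier.zero_mem).2 rfl]
  · have hmem : N⁻¹ • f ∈ (lebesgueSpace ∞ μ).carrier := Submodule.smul_mem _ _ hf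
    have hm : eLpNorm (N⁻¹ • f : ℝ →ₘ[μ] ℝ) ∞ μ = 1 := by
      have h := (lebesgueSpace ∞ μ).norm_smul N⁻¹ f hf
      rw [← hN, abs_of_pos (inv_pos.2 hpos), inv_mul_cancel₀ hpos.ne', lebesgueSpace_norm] at h
      exact (ENNReal.toReal_eq_one_iff _).1 h
    obtain ⟨h2, h3⟩ := hX.mul_mem hm h1
    rw [mul_one] at h2 h3
    have h4 := X.norm_smul N _ h2
    rw [smul_smul, mul_inv_cancel₀ hpos.ne', one_smul, abs_of_pos hpos] at h4
    rw [h4]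
    exact mul_le_mul_of_nonneg_left h3 hN0

end Multiplication

/-! ### Functions comparable to their value at the first atom -/

/-- The class of the characteristic function of the first atom. -/
noncomputable def firstAtom : ℝ →ₘ[dyadicMeasure] ℝ :=
  AEEqFun.mk (Set.indicator {1} 1)
    (measurable_one.indicator (measurableSet_singleton 1)).aestronglyMeasurable

theorem coeFn_firstAtom : ⇑firstAtom =ᵐ[dyadicMeasure] Set.indicator {1} 1 := AEEqFun.coeFn_mk _ _

theorem eLpNorm_top_firstAtom : eLpNorm firstAtom ∞ dyadicMeasure = 1 := by
  rw [eLpNorm_congr_ae coeFn_firstAtom, eLpNorm_exponent_top]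
  refine le_antisymm (essSup_le_of_ae_le _ (Filter.Eventually.of_forall fun x => ?_)) ?_
  · by_cases hx : x ∈ ({1} : Set ℝ) <;> simp [hx]
  · have := ae_dyadicMeasure_iff.1
      (enorm_ae_le_eLpNormEssSup (Set.indicator {1} (1 : ℝ → ℝ)) dyadicMeasure) 0
    simpa using this

theorem firstAtom_mem : firstAtom ∈ (lebesgueSpace ∞ dyadicMeasure).carrier := by
  rw [mem_lebesgueSpace_iff, eLpNorm_top_firstAtom]; exact ENNReal.one_lt_top

theorem firstAtom_ne_zero : firstAtom ≠ 0 := by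
  intro h
  have := eLpNorm_top_firstAtom
  rw [h, eLpNorm_congr_ae AEEqFun.coeFn_zero] at this
  simp at this

theorem firstAtom_mul_toClass {g : ℝ → ℝ≥0∞} (hg : Measurable g) :
    firstAtom * toClass dyadicMeasure g hg = (g 1).toReal • firstAtom := by
  refine AEEqFun.ext ?_
  filter_upwards [AEEqFun.coeFn_mul firstAtom (toClass dyadicMeasure g hg), coeFn_firstAtom,
    AEEqFun.coeFn_mk (μ := dyadicMeasure) (fun x => (g x).toReal)
      hg.ennreal_toReal.aestronglyMeasurable,
    AEEqFun.coeFn_smul (g 1).toReal firstAtom] with x h1 h2 h3 h4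
  rw [h1, h4, Pi.mul_apply, Pi.smul_apply, h2, toClass, h3, smul_eq_mul]
  by_cases hx : x = 1
  · subst hx; simp
  · simp [hx]

theorem IsExactInterpolationSpace.toClass_mem {X : BanachSubspace (ℝ →ₘ[dyadicMeasure] ℝ)}
    (hX : IsExactInterpolationSpace (lebesgueSpace 1 dyadicMeasure)
      (lebesgueSpace ∞ dyadicMeasure) X) {g : ℝ → ℝ≥0∞} (hg : Measurable g) {N : ℝ≥0∞}
    (hN : N ≠ ∞) (hle : N ≤ g 1) (hge : ∀ k : ℕ, g ((k + 1 : ℕ) : ℝ) ≤ 2 * N) :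
    toClass dyadicMeasure g hg ∈ X.carrier ∧
      X.norm firstAtom * N.toReal ≤ X.norm (toClass dyadicMeasure g hg) ∧
      X.norm (toClass dyadicMeasure g hg) ≤ (2 * X.norm 1) * N.toReal := by
  have hfin : 2 * N ≠ ∞ := ENNReal.mul_ne_top (by simp) hN
  -- Finiteness matters because `toReal` sends `∞` to `0`, which would destroy the lower bound.
  have hg1 : g 1 ≠ ∞ := ne_top_of_le_ne_top hfin (by simpa using hge 0)
  have hbd : eLpNorm (toClass dyadicMeasure g hg) ∞ dyadicMeasure ≤ 2 * N := by
    rw [toClass, eLpNorm_congr_ae (AEEqFun.coeFn_mk _ _), eLpNorm_exponent_top]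
    refine essSup_le_of_ae_le _ (ae_dyadicMeasure_iff.2 fun k => ?_)
    beta_reduce
    rw [Real.enorm_of_nonneg ENNReal.toReal_nonneg]
    exact ENNReal.ofReal_toReal_le.trans (hge k)
  have hmem : toClass dyadicMeasure g hg ∈ (lebesgueSpace ∞ dyadicMeasure).carrier :=
    mem_lebesgueSpace_iff.2 (hbd.trans_lt hfin.lt_top)
  have hmX := hX.mem_of_mem_top hmem
  have h1X := hX.mem_of_mem_top one_mem_lebesgueSpace_top
  have haX := hX.mem_of_mem_top firstAtom_mem
  refine ⟨hmX, ?_, ?_⟩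
  · have h := (hX.mul_mem eLpNorm_top_firstAtom hmX).2
    rw [firstAtom_mul_toClass, X.norm_smul _ _ haX, abs_of_nonneg ENNReal.toReal_nonneg] at h
    rw [mul_comm]
    exact (mul_le_mul_of_nonneg_right (ENNReal.toReal_mono hg1 hle)
      (X.norm_nonneg _ haX)).trans h
  · refine (hX.norm_le_mul_norm_one hmem).trans ?_
    have h := ENNReal.toReal_mono hfin hbd
    rw [ENNReal.toReal_mul, ENNReal.toReal_ofNat] at h
    calc _ ≤ (2 * N.toReal) * X.norm 1 := mul_le_mul_of_nonneg_right h (X.norm_nonneg _ h1X)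
      _ = _ := by ring

theorem leastDecreasingMajorant_one (f : ℝ → ℝ) :
    leastDecreasingMajorant dyadicMeasure f 1 = eLpNorm f ∞ dyadicMeasure := by
  rw [leastDecreasingMajorant, Measure.restrict_eq_self_of_ae_mem, eLpNorm_exponent_top,
    eLpNormEssSup]
  exact ae_dyadicMeasure_iff.2 fun k => by simp

/-! ### The two equivalences. -/

theorem mainTheorem12 (X : BanachSubspace (ℝ →ₘ[dyadicMeasure] ℝ))
    (hX : IsExactInterpolationSpace (lebesgueSpace 1 dyadicMeasure)
      (lebesgueSpace ∞ dyadicMeasure) X) :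
    (tildeSpace X = (lebesgueSpace ∞ dyadicMeasure).carrier ∧
      ∃ c > 0, ∃ C > 0, ∀ f ∈ (lebesgueSpace ∞ dyadicMeasure).carrier,
        c * (lebesgueSpace ∞ dyadicMeasure).norm f ≤ tildeNorm X f ∧
        tildeNorm X f ≤ C * (lebesgueSpace ∞ dyadicMeasure).norm f) ∧
    (levelSpace X = (lebesgueSpace 1 dyadicMeasure).carrier ∧
      ∃ c > 0, ∃ C > 0, ∀ f ∈ (lebesgueSpace 1 dyadicMeasure).carrier,
        c * (lebesgueSpace 1 dyadicMeasure).norm f ≤ levelNorm X f ∧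
        levelNorm X f ≤ C * (lebesgueSpace 1 dyadicMeasure).norm f) := by
  have h1X := hX.mem_of_mem_top one_mem_lebesgueSpace_top
  have haX := hX.mem_of_mem_top firstAtom_mem
  have ha : 0 < X.norm firstAtom := (X.norm_nonneg _ haX).lt_of_ne'
    (mt (X.norm_eq_zero _ haX).1 firstAtom_ne_zero)
  have h1 : 0 < X.norm 1 := by
    have h := hX.norm_le_mul_norm_one firstAtom_mem
    rw [lebesgueSpace_norm, eLpNorm_top_firstAtom, ENNReal.toReal_one, one_mul] at h
    exact ha.trans_le h
  have htilde : ∀ f : ℝ →ₘ[dyadicMeasure] ℝ, ∀ k : ℕ,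
      leastDecreasingMajorant dyadicMeasure f ((k + 1 : ℕ) : ℝ) ≤
        eLpNorm f ∞ dyadicMeasure := fun f k => by
    rw [← leastDecreasingMajorant_one]
    exact leastDecreasingMajorant_antitone _ _ (by simp)
  have tilde : ∀ f ∈ (lebesgueSpace ∞ dyadicMeasure).carrier, _ := fun f hf =>
    hX.toClass_mem (measurable_leastDecreasingMajorant dyadicMeasure f)
      (mem_lebesgueSpace_iff.1 hf).ne (leastDecreasingMajorant_one f).ge
      fun k => (htilde f k).trans (le_mul_of_one_le_left' one_le_two)
  have hlevel : ∀ f ∈ (lebesgueSpace 1 dyadicMeasure).carrier, ∀ k : ℕ,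
      levelFunction dyadicMeasure f ((k + 1 : ℕ) : ℝ) ≤ 2 * eLpNorm f 1 dyadicMeasure := by
    intro f hf k
    have hf := (mem_lebesgueSpace_iff.1 hf).ne
    rw [eLpNorm_one_eq_lintegral_enorm] at hf ⊢
    rw [levelFunction_of_lintegral_ne_top hf]
    exact density_le_two_mul_lintegral hf k
  have level : ∀ f ∈ (lebesgueSpace 1 dyadicMeasure).carrier, _ := fun f hf =>
    hX.toClass_mem (measurable_levelFunction dyadicMeasure f)
      (mem_lebesgueSpace_iff.1 hf).ne (by
        have hf := (mem_lebesgueSpace_iff.1 hf).ne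
        rw [eLpNorm_one_eq_lintegral_enorm] at hf ⊢
        rw [levelFunction_of_lintegral_ne_top hf]
        exact lintegral_le_density_one hf) (hlevel f hf)
  refine ⟨⟨Set.ext fun f => ⟨fun hf => ?_, fun hf => ⟨?_, (tilde f hf).1⟩⟩,
    X.norm firstAtom, ha, 2 * X.norm 1, by positivity, fun f hf => (tilde f hf).2⟩,
    ⟨Set.ext fun f => ⟨fun hf => ?_, fun hf => ⟨?_, (level f hf).1⟩⟩,
    X.norm firstAtom, ha, 2 * X.norm 1, by positivity, fun f hf => (level f hf).2⟩⟩
  -- Finiteness at the first atom alone gives this inclusion; membership in `X` plays no role, and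
  -- likewise for the level space.
  · have h := ae_dyadicMeasure_iff.1 hf.1 0
    rw [zero_add, Nat.cast_one, leastDecreasingMajorant_one] at h
    exact mem_lebesgueSpace_iff.2 h
  · exact ae_dyadicMeasure_iff.2 fun k =>
      (htilde f k).trans_lt (mem_lebesgueSpace_iff.1 hf)
  · have h := ae_dyadicMeasure_iff.1 hf.1 0
    rw [zero_add, Nat.cast_one] at h
    refine mem_lebesgueSpace_iff.2 (lt_top_iff_ne_top.2 fun htop => h.ne ?_)
    rw [eLpNorm_one_eq_lintegral_enorm] at htop
    exact levelFunction_one_of_lintegral_eq_top f.measurable htop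
  · exact ae_dyadicMeasure_iff.2 fun k => (hlevel f hf k).trans_lt
      (ENNReal.mul_lt_top (by simp) (mem_lebesgueSpace_iff.1 hf))
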